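/- **Setting.** Let $\rho$ be a nonzero measure on $\mathbb R$, let $\Theta=\{\theta:\int e^{\theta x}\,d\rho(x)<\infty\}$, let $b(\theta)=\log\int e^{\theta x}\,d\rho(x)$ be twice differentiable on $\Theta$ (one-sidedly at an endpoint that belongs to $\Theta$), and for $\theta\in\Theta$ let $\nu_\theta$ be the probability measure with density $e^{\theta x-b(\theta)}$ with respect to $\rho$. For $\theta,\theta'\in\Theta$, the means $\mu,\mu'$ of $\nu_\theta,\nu_{\theta'}$ satisfy $\mathrm{kl}(\mu,\mu')=b(\theta')-b(\theta)-b'(\theta)(\theta'-\theta)$ (Kullback–Leibler divergence). Let $K\ge 2$. A bandit instance consists of $K$ arms with distributions $\nu_{\theta_1},\dots,\nu_{\theta_K}$, $\theta_i\in\Theta$, with means $\mu_1,\dots,\mu_K$, such that there is a unique arm $i^*$ of largest mean (its index is not known to the agent); $\mathcal M$ is the set of all instances. An online algorithm picks at each time $t=1,2,\dots$ an arm $A_t$ (possibly at random) on the basis of $A_1,X_1,\dots,A_{t-1},X_{t-1}$, and then observes a reward $X_t$ drawn from the distribution of arm $A_t$ independently of the past; it stops at a stopping time $\tau$ of the filtration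 $\mathcal F_t=\sigma(A_1,X_1,\dots,A_t,X_t)$ and outputs an $\mathcal F_{\tau}$-measurable arm $i_{\rm out}$. For $\delta\in(0,1)$ it is $\delta$-PAC if $\mathbb P_\mu(\tau<\infty)=1$ and $\mathbb P_\mu(i_{\rm out}\ne i^*)\le\delta$ for every instance $\mu\in\mathcal M$. Write $R(\tau)=\sum_{t=1}^{\tau}(\mu_{i^*}-X_t)$. A family of $\delta$-PAC algorithms with stopping times $\tau_\delta$, one for each $\delta\in(0,1)$, is asymptotically optimal for regret if for every instance $\mu\in\mathcal M$ $$\limsup_{\delta\to0^+}\frac{\mathbb E_\mu[R(\tau_\delta)]}{\log(1/\delta)}\le\sum_{i\ne i^*}\frac{\mu_{i^*}-\mu_i}{\mathrm{kl}(\mu_i,\mu_{i^*})}.$$ **Theorem (impossibility result).** For every asymptotically optimal family of $\delta$-PAC algorithms and every instance $\mu\in\mathcal M$, $\mathbb E_\mu[\tau_\delta]=\omega(\log(1/\delta))$, that is, $$\liminf_{\delta\to0^+}\frac{\mathbb E_\mu[\tau_\delta]}{\log(1/\delta)}=\infty .$$ -/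

import Mathlib

open MeasureTheory ProbabilityTheory Filter Topology
open scoped ENNReal

namespace BAI

/-- A canonical single-parameter exponential family on `ℝ`, given by its (nonzero) reference
measure `ρ`. The natural parameter set is `Θ = {θ | ∫ exp (θ x) dρ < ∞}` and the log-partition
function is `b θ = log ∫ exp (θ x) dρ`; it is assumed to be twice differentiable on `Θ`
(one-sidedly at an endpoint of `Θ` that belongs to `Θ`, if there is one). -/
structure ExpFamily where
  /-- the reference measure -/
  ρ : Measure ℝ
  ρ_ne_zero : ρ ≠ 0
  differentiable : DifferentiableOn ℝ (cgf id ρ) (integrableExpSet id ρ)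
  twice_differentiable :
    DifferentiableOn ℝ (derivWithin (cgf id ρ) (integrableExpSet id ρ)) (integrableExpSet id ρ)

namespace ExpFamily

/-- The natural parameter set `{θ | ∫ exp (θ x) dρ < ∞}`. -/
def Θ (E : ExpFamily) : Set ℝ := integrableExpSet id E.ρ

/-- The log-partition function `b θ = log ∫ exp (θ x) dρ` (meaningful for `θ ∈ Θ`). -/
noncomputable def b (E : ExpFamily) (θ : ℝ) : ℝ := cgf id E.ρ θ

/-- The derivative `b'` of the log-partition function on `Θ`. -/
noncomputable def b' (E : ExpFamily) (θ : ℝ) : ℝ := derivWithin E.b E.Θ θ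

/-- The distribution `ν_θ`: the exponential tilting of `ρ`, see `dist_eq`. -/
noncomputable def dist (E : ExpFamily) (θ : ℝ) : Measure ℝ := E.ρ.tilted (fun x => θ * x)

/-- `ν_θ` has density `x ↦ exp (θ x - b θ)` with respect to `ρ`. -/
theorem dist_eq (E : ExpFamily) {θ : ℝ} (hθ : θ ∈ E.Θ) :
    E.dist θ = E.ρ.withDensity (fun x => ENNReal.ofReal (Real.exp (θ * x - E.b θ))) := by
  have : NeZero E.ρ := ⟨E.ρ_ne_zero⟩
  have hpos : 0 < ∫ x, Real.exp (θ * x) ∂E.ρ := integral_exp_pos hθ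
  simp only [dist, Measure.tilted, b, cgf, mgf, id]
  congr 1
  funext x
  rw [Real.exp_sub, Real.exp_log hpos]

theorem isProbabilityMeasure_dist (E : ExpFamily) {θ : ℝ} (hθ : θ ∈ E.Θ) :
    IsProbabilityMeasure (E.dist θ) := by
  have : NeZero E.ρ := ⟨E.ρ_ne_zero⟩
  exact isProbabilityMeasure_tilted hθ

/-- The mean of `ν_θ`. -/
noncomputable def mean (E : ExpFamily) (θ : ℝ) : ℝ := ∫ x, x ∂(E.dist θ)

/-- The Kullback-Leibler divergence between `ν_θ` and `ν_θ'`: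
`b θ' - b θ - b' θ (θ' - θ)`. -/
noncomputable def kl (E : ExpFamily) (θ θ' : ℝ) : ℝ :=
  E.b θ' - E.b θ - E.b' θ * (θ' - θ)

end ExpFamily

/-- A bandit instance with `K` arms: the arms have distributions from the family, and there is a
unique arm `best` of largest mean (its index is arbitrary and unknown to the agent). -/
structure Bandit (E : ExpFamily) (K : ℕ) where
  /-- the natural parameters of the arms -/
  θ : Fin K → ℝ
  mem : ∀ i, θ i ∈ E.Θ
  /-- the index of the best arm -/
  best : Fin K
  best_unique : ∀ i, i ≠ best → E.mean (θ i) < E.mean (θ best)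

namespace Bandit

variable {E : ExpFamily} {K : ℕ}

/-- The mean of arm `i`. -/
noncomputable def μ (B : Bandit E K) (i : Fin K) : ℝ := E.mean (B.θ i)

/-- The suboptimality gap of arm `i`. -/
noncomputable def gap (B : Bandit E K) (i : Fin K) : ℝ := B.μ B.best - B.μ i

/-- The hardness parameter: the sum of `gap i / kl (μ i, μ best)` over the suboptimal arms. -/
noncomputable def hardness (B : Bandit E K) : ℝ :=
  ∑ i ∈ Finset.univ.erase B.best, B.gap i / E.kl (B.θ i) (B.θ B.best)

/-- The reward distribution of the arm that is pulled, as a kernel. -/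
noncomputable def reward (B : Bandit E K) : Kernel (Fin K) ℝ :=
  Kernel.ofFunOfCountable (fun i => E.dist (B.θ i))

instance (B : Bandit E K) : IsMarkovKernel B.reward :=
  ⟨fun i => E.isProbabilityMeasure_dist (B.mem i)⟩

end Bandit

/-- An infinite record of play: `ω s` is the pair (arm, reward) of pull number `s + 1`. -/
abbrev Play (K : ℕ) : Type := ℕ → Fin K × ℝ

/-- The interaction filtration: at time `t` it is generated by the first `t` pulls
`(A_1, X_1, …, A_t, X_t)`, that is by `ω 0, …, ω (t - 1)`. -/
def history (K : ℕ) : Filtration ℕ (inferInstance : MeasurableSpace (Play K)) where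
  seq t := MeasurableSpace.comap (fun (ω : Play K) (s : Fin t) => ω s) inferInstance
  mono' t u htu := by
    have h : (fun (ω : Play K) (s : Fin t) => ω s) =
        (fun (x : Fin u → Fin K × ℝ) (s : Fin t) => x (Fin.castLE htu s)) ∘
          (fun (ω : Play K) (s : Fin u) => ω s) := rfl
    simp only
    rw [h, ← MeasurableSpace.comap_comp]
    exact MeasurableSpace.comap_mono
      (measurable_pi_lambda _ (fun s => measurable_pi_apply _)).comap_le
  le' t := (measurable_pi_lambda _ (fun s => measurable_pi_apply _)).comap_le

/-- An online algorithm for best arm identification with `K` arms. The sampling rule gives the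
conditional law of the next arm given the past pulls and rewards (a Dirac mass for a sampling rule
without randomization). -/
structure Algorithm (K : ℕ) where
  /-- sampling rule: law of the first arm -/
  first : Measure (Fin K)
  first_prob : IsProbabilityMeasure first
  /-- sampling rule: law of the arm of pull `n + 2`, given the pulls `1, …, n + 1` -/
  next : (n : ℕ) → Kernel (Finset.Iic n → Fin K × ℝ) (Fin K)
  next_markov : ∀ n, IsMarkovKernel (next n)
  /-- stopping rule: the number of pulls that are made -/
  τ : Play K → WithTop ℕ
  τ_stopping : IsStoppingTime (history K) τ
  /-- recommendation rule -/
  out : Play K → Fin K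
  out_measurable : Measurable[τ_stopping.measurableSpace] out

section

variable {E : ExpFamily} {K : ℕ}

instance (π : Algorithm K) : IsProbabilityMeasure π.first := π.first_prob

instance (π : Algorithm K) (n : ℕ) : IsMarkovKernel (π.next n) := π.next_markov n

/-- The conditional law of the next pair (arm, reward) given the past: the arm is chosen by the
sampling rule, and the reward is drawn from the distribution of this arm, independently of the
past. -/
noncomputable def stepKernel (B : Bandit E K) (π : Algorithm K) (n : ℕ) :
    Kernel (Finset.Iic n → Fin K × ℝ) (Fin K × ℝ) :=
  (π.next n) ⊗ₖ (B.reward.prodMkLeft (Finset.Iic n → Fin K × ℝ))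

instance (B : Bandit E K) (π : Algorithm K) (n : ℕ) : IsMarkovKernel (stepKernel B π n) := by
  unfold stepKernel; infer_instance

/-- The law of the interaction of the algorithm `π` with the instance `B`. -/
noncomputable def law (B : Bandit E K) (π : Algorithm K) : Measure (Play K) :=
  Kernel.trajMeasure (X := fun _ => Fin K × ℝ) (π.first ⊗ₘ B.reward) (stepKernel B π)

instance (B : Bandit E K) (π : Algorithm K) : IsProbabilityMeasure (law B π) := by
  unfold law; infer_instance

/-- The expected sample complexity, i.e. the expectation of `τ`. -/
noncomputable def expectedSamples (B : Bandit E K) (π : Algorithm K) : ℝ≥0∞ :=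
  ∫⁻ ω, ENat.toENNReal (π.τ ω) ∂(law B π)

/-- The cumulative regret `R(τ) = ∑_{t = 1}^{τ} (μ best - X_t)` up to the stopping time (on the
event that `τ` is infinite, which is null for the algorithms of interest, the value is `0`). -/
noncomputable def regret (B : Bandit E K) (π : Algorithm K) (ω : Play K) : ℝ :=
  ∑ s ∈ Finset.range ((π.τ ω).untopD 0), (B.μ B.best - (ω s).2)

/-- The expected cumulative regret, as the extended real `E[R⁺] - E[R⁻]`. (If both terms are
infinite, the value is `⊥`, so that such a case is never excluded by an upper bound.) -/
noncomputable def expectedRegret (B : Bandit E K) (π : Algorithm K) : EReal :=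
  ((∫⁻ ω, ENNReal.ofReal (regret B π ω) ∂(law B π) : ℝ≥0∞) : EReal) -
    ((∫⁻ ω, ENNReal.ofReal (-regret B π ω) ∂(law B π) : ℝ≥0∞) : EReal)

/-- `π` is `δ`-PAC: on every instance it stops almost surely, and the probability that it does not
recommend the best arm is at most `δ`. -/
def IsPAC (E : ExpFamily) (δ : ℝ) (π : Algorithm K) : Prop :=
  ∀ B : Bandit E K, (∀ᵐ ω ∂(law B π), π.τ ω ≠ ⊤) ∧
    law B π {ω | π.out ω ≠ B.best} ≤ ENNReal.ofReal δ

/-- A family of algorithms indexed by the confidence level is asymptotically optimal if on every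
instance `limsup_{δ → 0⁺} E[R(τ_δ)] / log (1/δ)` is at most the hardness parameter. -/
def IsAsymptoticallyOptimal (E : ExpFamily) (π : ℝ → Algorithm K) : Prop :=
  ∀ B : Bandit E K,
    limsup (fun δ : ℝ => expectedRegret B (π δ) / ((Real.log (1 / δ) : ℝ) : EReal)) (𝓝[>] 0)
      ≤ (B.hardness : EReal)

end

end BAI

/-!
Suppose that `𝔼 τ_δ ≤ C log (1/δ)` for a sequence of `δ → 0`. Fix a suboptimal arm `i` and write
`θ*` for the parameter of the best arm. In the alternative instance where arm `i` has the parameter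
`θ* - s` and the best arm is moved down to `θ* - 2 s`, arm `i` is the best one, so the algorithm has
to tell the two instances apart, which requires (`log_sub_two_le_sum_pulls`)

  `𝔼 N_i * kl (θ_i, θ* - s) + 𝔼 N_* * kl (θ*, θ* - 2 s) ≥ log (1/δ) - 2`,

where `N_a` is the number of pulls of arm `a`. Since `N_* ≤ τ_δ`, the second term is at most
`C kl (θ*, θ* - 2 s) log (1/δ)`, with a factor that is `o(s)`, whereas `kl (θ_i, θ* - s)` is smaller
than `kl (θ_i, θ*)` by an amount of order `s`, because `b' θ_i < b' θ*`. For a small fixed `s` this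
gives `𝔼 N_i ≥ (1 + ε) log (1/δ) / kl (θ_i, θ*)` for every suboptimal arm, with some `ε > 0`
(`eventually_kl_div_add_lt`). By Wald's identity (`expectedRegret_eq`) the expected regret is the
sum of `gap i * 𝔼 N_i`, which then exceeds the hardness times `log (1/δ)` by a constant factor,
against asymptotic optimality. Both alternative parameters lie below `θ*`, so an endpoint of `Θ` is
no obstacle.

The information inequality comes from a change of measure at the stopping time (`law_change`), the
tangent line inequality for `exp` and Wald's identity for the log-likelihood ratio
(`integral_stoppedSum`). The first moments and the identity `mean = b'`, also at an endpoint of `Θ`,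
are derived from the differentiability of `b` by Fatou's lemma and dominated convergence.
-/

/-! ### Exponential families: moments, means and divergences -/

namespace BAI
namespace ExpFamily

variable {E : ExpFamily} {θ θ' : ℝ}

theorem convex_Θ : Convex ℝ E.Θ := convex_integrableExpSet

theorem integrable_exp (hθ : θ ∈ E.Θ) : Integrable (fun x => Real.exp (θ * x)) E.ρ := hθ

theorem exp_b (hθ : θ ∈ E.Θ) : Real.exp (E.b θ) = ∫ x, Real.exp (θ * x) ∂E.ρ := by
  have : NeZero E.ρ := ⟨E.ρ_ne_zero⟩
  exact Real.exp_log (integral_exp_pos hθ)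

/-- Any member of the family is an exponential tilting of any other member. -/
theorem dist_tilted (hθ : θ ∈ E.Θ) :
    (E.dist θ).tilted (fun x => (θ' - θ) * x) = E.dist θ' := by
  rw [dist, tilted_tilted (integrable_exp hθ), dist]
  congr 1
  funext x
  simp only [Pi.add_apply]
  ring

theorem integrable_exp_dist (hθ : θ ∈ E.Θ) (hθ' : θ' ∈ E.Θ) :
    Integrable (fun x => Real.exp ((θ' - θ) * x)) (E.dist θ) := by
  rw [dist, integrable_tilted_iff (integrable_exp hθ)]
  refine Integrable.congr hθ' (Eventually.of_forall fun x => ?_)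
  simp only [smul_eq_mul, ← Real.exp_add, id]
  ring_nf

theorem integral_exp_dist (hθ : θ ∈ E.Θ) (hθ' : θ' ∈ E.Θ) :
    ∫ x, Real.exp ((θ' - θ) * x) ∂(E.dist θ) = Real.exp (E.b θ' - E.b θ) := by
  rw [dist, integral_exp_tilted, Real.exp_sub, exp_b hθ, exp_b hθ']
  congr 2
  funext x
  simp only [Pi.add_apply]
  ring_nf

/-- Change of measure between two members of the family. -/
theorem lintegral_dist (hθ : θ ∈ E.Θ) (hθ' : θ' ∈ E.Θ) (g : ℝ → ℝ≥0∞) :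
    ∫⁻ x, g x ∂(E.dist θ') =
      ∫⁻ x, ENNReal.ofReal (Real.exp ((θ' - θ) * x - (E.b θ' - E.b θ))) * g x ∂(E.dist θ) := by
  rw [← dist_tilted hθ, lintegral_tilted, integral_exp_dist hθ hθ']
  simp only [Real.exp_sub]

theorem le_exp_mul_sub_one_div {t : ℝ} (ht : 0 < t) (y : ℝ) : y ≤ (Real.exp (t * y) - 1) / t := by
  rw [le_div_iff₀ ht]
  linarith [Real.add_one_le_exp (t * y)]

theorem exp_mul_sub_one_div_le {t : ℝ} (ht : 0 < t) (ht1 : t ≤ 1) (y : ℝ) :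
    (Real.exp (t * y) - 1) / t ≤ Real.exp y - 1 := by
  rw [div_le_iff₀ ht]
  have h := convexOn_exp.2 (Set.mem_univ y) (Set.mem_univ 0) ht.le (sub_nonneg.2 ht1) (by ring)
  simp only [smul_eq_mul, mul_zero, add_zero, Real.exp_zero, mul_one] at h
  linarith

theorem hasDerivWithinAt_b (hθ : θ ∈ E.Θ) : HasDerivWithinAt E.b (E.b' θ) E.Θ θ :=
  (E.differentiable θ hθ).hasDerivWithinAt

/-- The difference quotients of `t ↦ 𝔼_θ[exp (t (θ' - θ) X)]` at `0⁺` converge. -/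
theorem tendsto_integral_quotient (hθ : θ ∈ E.Θ) (hθ' : θ' ∈ E.Θ) {t : ℕ → ℝ}
    (ht0 : ∀ n, 0 < t n) (ht1 : ∀ n, t n ≤ 1) (ht : Tendsto t atTop (𝓝 0)) :
    Tendsto (fun n => ∫ x, (Real.exp (t n * ((θ' - θ) * x)) - 1) / t n ∂(E.dist θ)) atTop
      (𝓝 (E.b' θ * (θ' - θ))) := by
  have := E.isProbabilityMeasure_dist hθ
  have hmem : ∀ s ∈ Set.Icc (0 : ℝ) 1, θ + s * (θ' - θ) ∈ E.Θ := fun s hs => by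
    simpa using convex_Θ.add_smul_sub_mem hθ hθ' hs
  have hd : HasDerivWithinAt (fun s : ℝ => Real.exp (E.b (θ + s * (θ' - θ)) - E.b θ))
      (E.b' θ * (θ' - θ)) (Set.Icc 0 1) 0 := by
    have h1 : HasDerivWithinAt (fun s : ℝ => θ + s * (θ' - θ)) (θ' - θ) (Set.Icc 0 1) 0 := by
      simpa using (((hasDerivAt_id (0 : ℝ)).mul_const (θ' - θ)).const_add θ).hasDerivWithinAt
    have h2 : HasDerivWithinAt E.b (E.b' θ) E.Θ (θ + 0 * (θ' - θ)) := by
      simpa using hasDerivWithinAt_b hθ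
    have h3 := ((h2.comp 0 h1 hmem).sub_const (E.b θ)).exp
    simpa using h3
  have hs := (hasDerivWithinAt_iff_tendsto_slope.1 hd).comp
    (tendsto_nhdsWithin_iff.2 ⟨ht, Eventually.of_forall fun n =>
      (⟨⟨(ht0 n).le, ht1 n⟩, (ht0 n).ne'⟩ : t n ∈ Set.Icc (0 : ℝ) 1 \ {0})⟩)
  refine hs.congr fun n => ?_
  have hm := hmem (t n) ⟨(ht0 n).le, ht1 n⟩
  have hi := integrable_exp_dist hθ hm
  have he := integral_exp_dist hθ hm
  simp only [add_sub_cancel_left, mul_assoc] at hi he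
  rw [integral_div, integral_sub hi (integrable_const _), he]
  simp [slope_def_field]

theorem tendsto_quotient (y : ℝ) {t : ℕ → ℝ} (ht0 : ∀ n, 0 < t n) (ht : Tendsto t atTop (𝓝 0)) :
    Tendsto (fun n => (Real.exp (t n * y) - 1) / t n) atTop (𝓝 y) := by
  have hd : HasDerivAt (fun s : ℝ => Real.exp (s * y)) y 0 := by
    simpa using ((hasDerivAt_id (0 : ℝ)).mul_const y).exp
  have hs := (hasDerivAt_iff_tendsto_slope.1 hd).comp
    (tendsto_nhdsWithin_iff.2 ⟨ht, Eventually.of_forall fun n => (ht0 n).ne'⟩)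
  refine hs.congr fun n => ?_
  simp [slope_def_field]

/-- One-sided differentiability of the log-partition function suffices for `ν_θ` to have a first
moment: the difference quotients `(exp (t y) - 1) / t` decrease to `y` as `t` decreases to `0`, so
Fatou's lemma applies to their distance to the first one. -/
theorem integrable_mul_dist (hθ : θ ∈ E.Θ) (hθ' : θ' ∈ E.Θ) :
    Integrable (fun x => (θ' - θ) * x) (E.dist θ) := by
  have := E.isProbabilityMeasure_dist hθ
  set t : ℕ → ℝ := fun n => 1 / ((n : ℝ) + 1) with ht_def
  have ht0 : ∀ n, 0 < t n := fun n => Nat.one_div_pos_of_nat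
  have ht1 : ∀ n, t n ≤ 1 := fun n => by
    rw [ht_def, div_le_one (by positivity)]
    simp
  have ht : Tendsto t atTop (𝓝 0) := tendsto_one_div_add_atTop_nhds_zero_nat
  have hI : Integrable (fun x => Real.exp ((θ' - θ) * x) - 1) (E.dist θ) :=
    (integrable_exp_dist hθ hθ').sub (integrable_const _)
  have hq : ∀ n, Integrable (fun x => (Real.exp (t n * ((θ' - θ) * x)) - 1) / t n) (E.dist θ) := by
    intro n
    have hm : θ + t n * (θ' - θ) ∈ E.Θ := by
      simpa using convex_Θ.add_smul_sub_mem hθ hθ' ⟨(ht0 n).le, ht1 n⟩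
    have hi := integrable_exp_dist hθ hm
    simp only [add_sub_cancel_left, mul_assoc] at hi
    exact (hi.sub (integrable_const _)).div_const _
  have key : Integrable (fun x => (Real.exp ((θ' - θ) * x) - 1) - (θ' - θ) * x) (E.dist θ) := by
    refine integrable_of_tendsto
      (G := fun n x => (Real.exp ((θ' - θ) * x) - 1) -
        (Real.exp (t n * ((θ' - θ) * x)) - 1) / t n)
      (Eventually.of_forall fun x => (tendsto_quotient _ ht0 ht).const_sub _)
      (fun n => (hI.sub (hq n)).aestronglyMeasurable) ?_
    have hlim : Tendsto (fun n => ∫⁻ x, ‖(Real.exp ((θ' - θ) * x) - 1) -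
        (Real.exp (t n * ((θ' - θ) * x)) - 1) / t n‖ₑ ∂(E.dist θ)) atTop
        (𝓝 (ENNReal.ofReal ((∫ x, (Real.exp ((θ' - θ) * x) - 1) ∂(E.dist θ)) -
          E.b' θ * (θ' - θ)))) := by
      refine (ENNReal.tendsto_ofReal
        ((tendsto_integral_quotient hθ hθ' ht0 ht1 ht).const_sub _)).congr fun n => ?_
      have hnn : ∀ x, 0 ≤ (Real.exp ((θ' - θ) * x) - 1) -
          (Real.exp (t n * ((θ' - θ) * x)) - 1) / t n := fun x =>
        sub_nonneg.2 (exp_mul_sub_one_div_le (ht0 n) (ht1 n) _)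
      rw [← integral_sub hI (hq n), ofReal_integral_eq_lintegral_ofReal
        (f := fun x => (Real.exp ((θ' - θ) * x) - 1) -
          (Real.exp (t n * ((θ' - θ) * x)) - 1) / t n)
        (hI.sub (hq n)) (Eventually.of_forall hnn)]
      exact lintegral_congr fun x => (Real.enorm_of_nonneg (hnn x)).symm
    rw [hlim.liminf_eq]
    exact ENNReal.ofReal_ne_top
  refine (hI.sub key).congr (Eventually.of_forall fun x => ?_)
  simp

theorem integrable_id_dist (hθ : θ ∈ E.Θ) (hθ' : θ' ∈ E.Θ) (hne : θ' ≠ θ) :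
    Integrable (fun x => x) (E.dist θ) := by
  have h := (integrable_mul_dist hθ hθ').const_mul (θ' - θ)⁻¹
  refine h.congr (Eventually.of_forall fun x => ?_)
  simp only
  rw [inv_mul_cancel_left₀ (sub_ne_zero.2 hne)]

/-- The derivative of the log-partition function is the mean, also at an endpoint of `Θ`. -/
theorem mean_eq_b' (hθ : θ ∈ E.Θ) (hθ' : θ' ∈ E.Θ) (hne : θ' ≠ θ) : E.mean θ = E.b' θ := by
  have := E.isProbabilityMeasure_dist hθ
  set t : ℕ → ℝ := fun n => 1 / ((n : ℝ) + 1) with ht_def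
  have ht0 : ∀ n, 0 < t n := fun n => Nat.one_div_pos_of_nat
  have ht1 : ∀ n, t n ≤ 1 := fun n => by
    rw [ht_def, div_le_one (by positivity)]
    simp
  have ht : Tendsto t atTop (𝓝 0) := tendsto_one_div_add_atTop_nhds_zero_nat
  have hI : Integrable (fun x => Real.exp ((θ' - θ) * x) - 1) (E.dist θ) :=
    (integrable_exp_dist hθ hθ').sub (integrable_const _)
  have h1 := tendsto_integral_quotient hθ hθ' ht0 ht1 ht
  have h2 : Tendsto (fun n => ∫ x, (Real.exp (t n * ((θ' - θ) * x)) - 1) / t n ∂(E.dist θ)) atTop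
      (𝓝 (∫ x, (θ' - θ) * x ∂(E.dist θ))) := by
    refine tendsto_integral_of_dominated_convergence
      (fun x => |(θ' - θ) * x| + |Real.exp ((θ' - θ) * x) - 1|)
      (fun n => by fun_prop) ((integrable_mul_dist hθ hθ').abs.add hI.abs) (fun n => ?_)
      (Eventually.of_forall fun x => tendsto_quotient _ ht0 ht)
    refine Eventually.of_forall fun x => ?_
    have hlo := le_exp_mul_sub_one_div (ht0 n) ((θ' - θ) * x)
    have hhi := exp_mul_sub_one_div_le (ht0 n) (ht1 n) ((θ' - θ) * x)
    rw [Real.norm_eq_abs, abs_le]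
    constructor
    · linarith [neg_abs_le ((θ' - θ) * x), abs_nonneg (Real.exp ((θ' - θ) * x) - 1)]
    · linarith [le_abs_self (Real.exp ((θ' - θ) * x) - 1), abs_nonneg ((θ' - θ) * x)]
  have h3 := tendsto_nhds_unique h1 h2
  rw [integral_const_mul, mul_comm] at h3
  exact (mul_left_cancel₀ (sub_ne_zero.2 hne) h3).symm

/-- If `ρ` is carried by a single point, all members of the family have the same mean. -/
theorem not_ae_const_of_mean_ne (hθ : θ ∈ E.Θ) (hθ' : θ' ∈ E.Θ) (hne : E.mean θ ≠ E.mean θ')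
    (c : ℝ) : ¬ ∀ᵐ x ∂E.ρ, x = c := by
  intro h
  have hm : ∀ η ∈ E.Θ, E.mean η = c := fun η hη => by
    have := E.isProbabilityMeasure_dist hη
    have h' : ∀ᵐ x ∂(E.dist η), x = c := (tilted_absolutelyContinuous _ _).ae_le h
    rw [mean, integral_congr_ae (g := fun _ => c) h']
    simp
  exact hne ((hm θ hθ).trans (hm θ' hθ').symm)

/-- The divergence between distinct members of a nondegenerate family is positive: with
`U = (θ' - θ) (X - 𝔼_θ X)` it equals `log 𝔼_θ[exp U]`, and `exp U ≥ 1 + U` is strict unless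
`U = 0`. -/
theorem kl_pos (hρ : ∀ c : ℝ, ¬ ∀ᵐ x ∂E.ρ, x = c) (hθ : θ ∈ E.Θ) (hθ' : θ' ∈ E.Θ)
    (hne : θ' ≠ θ) : 0 < E.kl θ θ' := by
  have := E.isProbabilityMeasure_dist hθ
  set m := E.mean θ with hm
  set U : ℝ → ℝ := fun x => (θ' - θ) * x - (θ' - θ) * m with hU
  have hIx := integrable_mul_dist hθ hθ'
  have hIU : Integrable U (E.dist θ) := hIx.sub (integrable_const _)
  have hUe : ∀ x, Real.exp (U x) = Real.exp (-((θ' - θ) * m)) * Real.exp ((θ' - θ) * x) :=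
    fun x => by rw [← Real.exp_add, hU]; ring_nf
  have hIe : Integrable (fun x => Real.exp (U x)) (E.dist θ) := by
    simp only [hUe]
    exact (integrable_exp_dist hθ hθ').const_mul _
  have hint : ∫ x, Real.exp (U x) ∂(E.dist θ) = Real.exp (E.kl θ θ') := by
    simp only [hUe]
    rw [integral_const_mul, integral_exp_dist hθ hθ', ← Real.exp_add, kl,
      ← mean_eq_b' hθ hθ' hne, ← hm]
    ring_nf
  have hU0 : ∫ x, U x ∂(E.dist θ) = 0 := by
    rw [hU, integral_sub hIx (integrable_const _), integral_const_mul]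
    simp [hm, mean]
  have hIf : Integrable (fun x => Real.exp (U x) - 1 - U x) (E.dist θ) :=
    (hIe.sub (integrable_const _)).sub hIU
  have hnn : ∀ x, 0 ≤ Real.exp (U x) - 1 - U x := fun x => by
    linarith [Real.add_one_le_exp (U x)]
  have hfi : ∫ x, (Real.exp (U x) - 1 - U x) ∂(E.dist θ) = Real.exp (E.kl θ θ') - 1 := by
    rw [integral_sub (f := fun x => Real.exp (U x) - 1) (hIe.sub (integrable_const _)) hIU,
      integral_sub hIe (integrable_const _),
      hint, hU0]
    simp
  have hpos : 0 < ∫ x, (Real.exp (U x) - 1 - U x) ∂(E.dist θ) := by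
    refine lt_of_le_of_ne (integral_nonneg hnn) fun h0 => hρ m ?_
    have h := (integral_eq_zero_iff_of_nonneg hnn hIf).1 h0.symm
    refine (absolutelyContinuous_tilted hθ).ae_le ?_
    filter_upwards [h] with x hx
    by_contra hxm
    have hUx : U x ≠ 0 := by
      rw [hU]
      simp only [← mul_sub]
      exact mul_ne_zero (sub_ne_zero.2 hne) (sub_ne_zero.2 hxm)
    have := Real.add_one_lt_exp hUx
    simp only [Pi.zero_apply] at hx
    linarith
  rw [hfi] at hpos
  exact Real.one_lt_exp_iff.1 (by linarith)

theorem kl_self (θ : ℝ) : E.kl θ θ = 0 := by simp [kl]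

theorem strictMonoOn_mean (hρ : ∀ c : ℝ, ¬ ∀ᵐ x ∂E.ρ, x = c) : StrictMonoOn E.mean E.Θ := by
  intro η hη η' hη' hlt
  have h1 := kl_pos hρ hη hη' hlt.ne'
  have h2 := kl_pos hρ hη' hη hlt.ne
  rw [kl, ← mean_eq_b' hη hη' hlt.ne'] at h1
  rw [kl, ← mean_eq_b' hη' hη hlt.ne] at h2
  nlinarith

end ExpFamily
end BAI

/-! ### The law of the interaction -/

namespace BAI

variable {E : ExpFamily} {K : ℕ}

/-- The first `n` pulls of a play. The σ-algebra `history K n` is generated by this map. -/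
def past (n : ℕ) (ω : Play K) : Fin n → Fin K × ℝ := fun s => ω s

theorem measurableSet_history_iff {n : ℕ} {A : Set (Play K)} :
    MeasurableSet[history K n] A ↔
      ∃ T : Set (Fin n → Fin K × ℝ), MeasurableSet T ∧ past n ⁻¹' T = A := Iff.rfl

/-- A record of `n + 1` pulls, with the index type that the sampling rule expects. -/
def toIic (n : ℕ) (h : Fin (n + 1) → Fin K × ℝ) : Finset.Iic n → Fin K × ℝ :=
  fun i => h ⟨i, Nat.lt_succ_of_le (Finset.mem_Iic.1 i.2)⟩

theorem measurable_toIic (n : ℕ) : Measurable (toIic (K := K) n) :=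
  measurable_pi_lambda _ fun _ => measurable_pi_apply _

/-- The law of the arm of pull `n + 1` given the first `n` pulls. This treats the first pull and
the later ones uniformly, and it does not depend on the instance. -/
noncomputable def armLaw (π : Algorithm K) : (n : ℕ) → Kernel (Fin n → Fin K × ℝ) (Fin K)
  | 0 => Kernel.const _ π.first
  | n + 1 => (π.next n).comap (toIic n) (measurable_toIic n)

instance (π : Algorithm K) (n : ℕ) : IsMarkovKernel (armLaw π n) := by
  cases n <;> (unfold armLaw; infer_instance)

theorem map_zero_law (B : Bandit E K) (π : Algorithm K) :
    (law B π).map (fun ω => ω 0) = π.first ⊗ₘ B.reward := by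
  have h1 : (law B π).map (Preorder.frestrictLe 0) =
      (π.first ⊗ₘ B.reward).map
        (MeasurableEquiv.piUnique (fun _ : Finset.Iic 0 => Fin K × ℝ)).symm := by
    rw [law, Kernel.trajMeasure, Measure.map_comp _ _ (by fun_prop), Kernel.traj_map_frestrictLe,
      Kernel.partialTraj_self, Measure.id_comp]
  have h2 : (fun ω : Play K => ω 0) =
      (MeasurableEquiv.piUnique (fun _ : Finset.Iic 0 => Fin K × ℝ)) ∘
        (Preorder.frestrictLe (π := fun _ => Fin K × ℝ) 0) := rfl
  rw [h2, ← Measure.map_map (MeasurableEquiv.measurable _) (by fun_prop), h1,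
    MeasurableEquiv.map_map_symm]

theorem lintegral_law_succ (B : Bandit E K) (π : Algorithm K) (n : ℕ)
    {f : (Finset.Iic n → Fin K × ℝ) × (Fin K × ℝ) → ℝ≥0∞} (hf : Measurable f) :
    ∫⁻ ω, f (Preorder.frestrictLe n ω, ω (n + 1)) ∂(law B π) =
      ∫⁻ ω, ∫⁻ y, f (Preorder.frestrictLe n ω, y)
        ∂(stepKernel B π n (Preorder.frestrictLe n ω)) ∂(law B π) := by
  have h := Kernel.map_frestrictLe_trajMeasure_compProd_eq_map_trajMeasure
    (X := fun _ => Fin K × ℝ) (μ₀ := π.first ⊗ₘ B.reward) (κ := stepKernel B π) (a := n)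
  have hm : Measurable fun x : Play K => (Preorder.frestrictLe n x, x (n + 1)) := by fun_prop
  have h1 := lintegral_map (μ := law B π) hf hm
  rw [← h1, law, ← h, Measure.lintegral_compProd hf,
    lintegral_map hf.lintegral_kernel_prod_right' (by fun_prop)]

/-- The dynamics of the interaction: given the past, the next arm is drawn from the sampling rule
and the reward from the distribution of this arm. -/
theorem lintegral_law_step (B : Bandit E K) (π : Algorithm K) (n : ℕ)
    {f : (Fin n → Fin K × ℝ) × (Fin K × ℝ) → ℝ≥0∞} (hf : Measurable f) :
    ∫⁻ ω, f (past n ω, ω n) ∂(law B π) =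
      ∫⁻ ω, ∫⁻ a, ∫⁻ x, f (past n ω, (a, x)) ∂(E.dist (B.θ a)) ∂(armLaw π n (past n ω))
        ∂(law B π) := by
  cases n with
  | zero =>
    have hpast : ∀ ω : Play K, past 0 ω = default := fun ω => Subsingleton.elim _ _
    have hf' : Measurable fun y => f (default, y) := hf.comp measurable_prodMk_left
    simp only [hpast]
    rw [← lintegral_map (f := fun y => f (default, y)) (g := fun ω : Play K => ω 0) hf'
      (measurable_pi_apply 0), map_zero_law, Measure.lintegral_compProd hf', lintegral_const,
      measure_univ, mul_one]
    rfl
  | succ n =>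
    have hg : Measurable fun p : (Finset.Iic n → Fin K × ℝ) × (Fin K × ℝ) =>
        f (fun i => p.1 ⟨i, Finset.mem_Iic.2 (Nat.le_of_lt_succ i.2)⟩, p.2) := by
      refine hf.comp (Measurable.prodMk ?_ measurable_snd)
      exact measurable_pi_lambda _ fun _ => (measurable_pi_apply _).comp measurable_fst
    refine (lintegral_law_succ B π n hg).trans (lintegral_congr fun ω => ?_)
    exact Kernel.lintegral_compProd _ _ _ (hg.comp measurable_prodMk_left)

theorem measurable_snoc (n : ℕ) :
    Measurable fun p : (Fin n → Fin K × ℝ) × (Fin K × ℝ) =>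
      (Fin.snoc p.1 p.2 : Fin (n + 1) → Fin K × ℝ) := by
  refine measurable_pi_lambda _ fun i => ?_
  induction i using Fin.lastCases with
  | last => simpa using measurable_snd
  | cast i =>
    simp only [Fin.snoc_castSucc]
    exact (measurable_pi_apply i).comp measurable_fst

theorem past_succ (n : ℕ) (ω : Play K) :
    past (n + 1) ω = (Fin.snoc (past n ω) (ω n) : Fin (n + 1) → Fin K × ℝ) := by
  funext i
  induction i using Fin.lastCases with
  | last => simp [past]
  | cast i => simp [past]

/-- The log-likelihood ratio of a pull under `B` against `B'`. -/
noncomputable def llr (B B' : Bandit E K) (y : Fin K × ℝ) : ℝ :=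
  (E.b (B'.θ y.1) - E.b (B.θ y.1)) - (B'.θ y.1 - B.θ y.1) * y.2

theorem measurable_of_arms {β : Type*} [MeasurableSpace β] {f : Fin K × ℝ → β}
    (hf : ∀ a, Measurable fun x => f (a, x)) : Measurable f :=
  measurable_from_prod_countable_right hf

theorem measurable_llr (B B' : Bandit E K) : Measurable (llr B B') :=
  measurable_of_arms fun a => by simp only [llr]; exact (measurable_id.const_mul _).const_sub _

theorem lintegral_dist_llr (B B' : Bandit E K) (a : Fin K) (g : ℝ → ℝ≥0∞) :
    ∫⁻ x, g x ∂(E.dist (B'.θ a)) =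
      ∫⁻ x, ENNReal.ofReal (Real.exp (-llr B B' (a, x))) * g x ∂(E.dist (B.θ a)) := by
  rw [ExpFamily.lintegral_dist (B.mem a) (B'.mem a)]
  simp only [llr, neg_sub]

theorem measurable_lintegral_reward (B : Bandit E K) {n : ℕ}
    {F : (Fin n → Fin K × ℝ) × (Fin K × ℝ) → ℝ≥0∞} (hF : Measurable F) :
    Measurable fun p : (Fin n → Fin K × ℝ) × Fin K =>
      ∫⁻ x, F (p.1, (p.2, x)) ∂(E.dist (B.θ p.2)) := by
  have h : Measurable fun q : ((Fin n → Fin K × ℝ) × Fin K) × ℝ => F (q.1.1, (q.1.2, q.2)) :=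
    hF.comp (by fun_prop)
  exact Measurable.lintegral_kernel_prod_right' (κ := B.reward.prodMkLeft (Fin n → Fin K × ℝ)) h

/-- Change of measure at a fixed time: on the first `n` pulls, the law under `B'` has density
`exp (-∑ llr)` with respect to the law under `B`. -/
theorem lintegral_past_change (B B' : Bandit E K) (π : Algorithm K) (n : ℕ)
    {g : (Fin n → Fin K × ℝ) → ℝ≥0∞} (hg : Measurable g) :
    ∫⁻ ω, g (past n ω) ∂(law B' π) =
      ∫⁻ ω, ENNReal.ofReal (Real.exp (-∑ s, llr B B' (past n ω s))) * g (past n ω)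
        ∂(law B π) := by
  induction n with
  | zero =>
    have hpast : ∀ ω : Play K, past 0 ω = default := fun ω => Subsingleton.elim _ _
    simp [hpast]
  | succ n ih =>
    have hl := measurable_llr B B'
    obtain ⟨G, hG, hGg⟩ : ∃ G : (Fin n → Fin K × ℝ) × (Fin K × ℝ) → ℝ≥0∞, Measurable G ∧
        ∀ ω : Play K, g (past (n + 1) ω) = G (past n ω, ω n) :=
      ⟨_, hg.comp (measurable_snoc n), fun ω => congrArg g (past_succ n ω)⟩
    obtain ⟨r, hr, hrl⟩ : ∃ r : Fin K × ℝ → ℝ≥0∞, Measurable r ∧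
        ∀ y, r y = ENNReal.ofReal (Real.exp (-llr B B' y)) :=
      ⟨_, by fun_prop, fun y => rfl⟩
    obtain ⟨D, hD, hDl⟩ : ∃ D : (Fin n → Fin K × ℝ) → ℝ≥0∞, Measurable D ∧
        ∀ h, D h = ENNReal.ofReal (Real.exp (-∑ s, llr B B' (h s))) :=
      ⟨_, by fun_prop, fun y => rfl⟩
    -- the density factorizes into the density of the past and that of the last pull
    have hfac : ∀ ω : Play K,
        ENNReal.ofReal (Real.exp (-∑ s, llr B B' (past (n + 1) ω s))) =
          D (past n ω) * r (ω n) := fun ω => by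
      rw [Fin.sum_univ_castSucc, hDl, hrl, ← ENNReal.ofReal_mul (Real.exp_pos _).le,
        ← Real.exp_add, neg_add]
      rfl
    have hrG : Measurable fun p : (Fin n → Fin K × ℝ) × (Fin K × ℝ) => r p.2 * G p :=
      (hr.comp measurable_snd).mul hG
    have hDrG : Measurable fun p : (Fin n → Fin K × ℝ) × (Fin K × ℝ) => D p.1 * (r p.2 * G p) :=
      (hD.comp measurable_fst).mul hrG
    have hI := measurable_lintegral_reward B hrG
    have hstep := lintegral_law_step B π n hDrG
    have hdist : ∀ (h : Fin n → Fin K × ℝ) (a : Fin K),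
        ∫⁻ x, G (h, (a, x)) ∂(E.dist (B'.θ a)) =
          ∫⁻ x, r (a, x) * G (h, (a, x)) ∂(E.dist (B.θ a)) := fun h a => by
      rw [lintegral_dist_llr B B' a]
      simp only [hrl]
    simp only [hfac, hGg, mul_assoc]
    rw [lintegral_law_step B' π n hG, hstep]
    simp only [hdist]
    rw [ih (g := fun h => ∫⁻ a, ∫⁻ x, r (a, x) * G (h, (a, x)) ∂(E.dist (B.θ a))
      ∂(armLaw π n h)) hI.lintegral_kernel_prod_right']
    refine lintegral_congr fun ω => ?_
    rw [← hDl, ← lintegral_const_mul _ Measurable.of_discrete]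
    refine lintegral_congr fun a => ?_
    rw [← lintegral_const_mul]
    exact hrG.comp (measurable_prodMk_left.comp measurable_prodMk_left)

/-! ### Sums up to the stopping time, change of measure and Wald's identity -/

/-- The sum of `φ` over the pulls that are made before the algorithm stops (an empty sum if it
does not stop). -/
noncomputable def stoppedSum {M : Type*} [AddCommMonoid M] (π : Algorithm K) (φ : Fin K × ℝ → M)
    (ω : Play K) : M :=
  ∑ s ∈ Finset.range ((π.τ ω).untopD 0), φ (ω s)

theorem measurable_τ (π : Algorithm K) : Measurable π.τ := π.τ_stopping.measurable'

theorem measurable_stoppedSum {M : Type*} [AddCommMonoid M] [MeasurableSpace M] [MeasurableAdd₂ M]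
    (π : Algorithm K) {φ : Fin K × ℝ → M} (hφ : Measurable φ) : Measurable (stoppedSum π φ) := by
  have hN : Measurable fun ω => (π.τ ω).untopD 0 :=
    (Measurable.of_discrete (f := fun t : WithTop ℕ => t.untopD 0)).comp (measurable_τ π)
  have h : Measurable fun p : ℕ × Play K => ∑ s ∈ Finset.range p.1, φ (p.2 s) :=
    measurable_from_prod_countable_right fun n =>
      Finset.measurable_fun_sum (Finset.range n) fun s _ => hφ.comp (measurable_pi_apply s)
  exact h.comp (hN.prodMk measurable_id)

/-- The event that the algorithm stops after exactly `n` pulls, intersected with an event known at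
the stopping time, is determined by the first `n` pulls. -/
theorem measurableSet_inter_τ_eq (π : Algorithm K) {A : Set (Play K)}
    (hA : MeasurableSet[π.τ_stopping.measurableSpace] A) (n : ℕ) :
    MeasurableSet[history K n] (A ∩ {ω | π.τ ω = n}) :=
  (π.τ_stopping.measurableSet_inter_eq_iff A n).1 (hA.inter (π.τ_stopping.measurableSet_eq' n))

/-- Change of measure at the stopping time. -/
theorem law_change (B B' : Bandit E K) (π : Algorithm K) {A : Set (Play K)}
    (hA : MeasurableSet[π.τ_stopping.measurableSpace] A)
    (hB : ∀ᵐ ω ∂(law B π), π.τ ω ≠ ⊤) (hB' : ∀ᵐ ω ∂(law B' π), π.τ ω ≠ ⊤) :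
    law B' π A = ∫⁻ ω in A, ENNReal.ofReal (Real.exp (-stoppedSum π (llr B B') ω)) ∂(law B π) := by
  set S : ℕ → Set (Play K) := fun n => A ∩ {ω | π.τ ω = n} with hS
  have hSm : ∀ n, MeasurableSet (S n) := fun n =>
    (history K).le n _ (measurableSet_inter_τ_eq π hA n)
  have hdisj : Pairwise (Function.onFun Disjoint S) := by
    intro m n hmn
    rw [Function.onFun, Set.disjoint_left]
    rintro ω ⟨-, h1⟩ ⟨-, h2⟩
    exact hmn (WithTop.coe_injective ((show π.τ ω = m from h1).symm.trans h2))
  have hU : ∀ ν : Measure (Play K), (∀ᵐ ω ∂ν, π.τ ω ≠ ⊤) → A =ᵐ[ν] ⋃ n, S n := by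
    intro ν hν
    filter_upwards [hν] with ω hω
    refine propext ⟨fun h => ?_, fun h => ?_⟩
    · obtain ⟨n, hn⟩ := WithTop.ne_top_iff_exists.1 hω
      exact Set.mem_iUnion.2 ⟨n, h, hn.symm⟩
    · obtain ⟨n, hn⟩ := Set.mem_iUnion.1 h
      exact hn.1
  rw [measure_congr (hU _ hB'), measure_iUnion hdisj hSm, setLIntegral_congr (hU _ hB),
    lintegral_iUnion hSm hdisj]
  congr 1
  funext n
  obtain ⟨T, hT, hTS⟩ := measurableSet_history_iff.1 (measurableSet_inter_τ_eq π hA n)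
  have h := lintegral_past_change B B' π n (g := T.indicator 1) (measurable_one.indicator hT)
  have hind : ∀ ω : Play K, T.indicator (1 : (Fin n → Fin K × ℝ) → ℝ≥0∞) (past n ω) = (S n).indicator 1 ω := by
    intro ω
    rw [hS]
    simp only
    rw [← hTS]
    rfl
  simp only [hind] at h
  rw [lintegral_indicator_one (hSm n)] at h
  rw [h, ← lintegral_indicator (hSm n)]
  refine lintegral_congr fun ω => ?_
  by_cases hω : ω ∈ S n
  · have hτ : π.τ ω = n := hω.2
    rw [Set.indicator_of_mem hω, Set.indicator_of_mem hω, Pi.one_apply, mul_one, stoppedSum, hτ]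
    congr 3
    rw [← Fin.sum_univ_eq_sum_range (fun s => llr B B' (ω s))]
    rfl
  · simp [Set.indicator_of_notMem hω]

/-- Wald's identity for nonnegative summands: each reward may be replaced by its conditional
expectation given the arm, since the decision to make a pull depends only on the past. -/
theorem lintegral_stoppedSum (B : Bandit E K) (π : Algorithm K)
    (hB : ∀ᵐ ω ∂(law B π), π.τ ω ≠ ⊤) {g : Fin K × ℝ → ℝ≥0∞} (hg : Measurable g) :
    ∫⁻ ω, stoppedSum π g ω ∂(law B π) =
      ∫⁻ ω, stoppedSum π (fun y => ∫⁻ x, g (y.1, x) ∂(E.dist (B.θ y.1))) ω ∂(law B π) := by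
  have hm : ∀ s : ℕ, MeasurableSet[history K s] {ω | (s : WithTop ℕ) < π.τ ω} := fun s => by
    have h := (π.τ_stopping s).compl
    have : {ω | (s : WithTop ℕ) < π.τ ω} = {ω | π.τ ω ≤ s}ᶜ := by
      ext ω
      simp
    rw [this]
    exact h
  have hsum : ∀ φ : Fin K × ℝ → ℝ≥0∞, Measurable φ →
      ∫⁻ ω, stoppedSum π φ ω ∂(law B π) =
        ∑' s : ℕ, ∫⁻ ω, {ω | (s : WithTop ℕ) < π.τ ω}.indicator (fun ω => φ (ω s)) ω
          ∂(law B π) := by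
    intro φ hφ
    have hms : ∀ s : ℕ, Measurable ({ω | (s : WithTop ℕ) < π.τ ω}.indicator
        fun ω : Play K => φ (ω s)) := fun s =>
      (hφ.comp (measurable_pi_apply s)).indicator ((history K).le s _ (hm s))
    rw [← lintegral_tsum fun s => (hms s).aemeasurable]
    refine lintegral_congr_ae ?_
    filter_upwards [hB] with ω hω
    obtain ⟨n, hn⟩ := WithTop.ne_top_iff_exists.1 hω
    rw [stoppedSum, ← hn, WithTop.untopD_coe, tsum_eq_sum (s := Finset.range n)]
    · refine Finset.sum_congr rfl fun s hs => ?_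
      rw [Set.indicator_of_mem]
      rw [Set.mem_ofPred_eq, ← hn]
      exact WithTop.coe_lt_coe.2 (Finset.mem_range.1 hs)
    · intro s hs
      rw [Set.indicator_of_notMem]
      rw [Set.mem_ofPred_eq, ← hn, not_lt]
      exact WithTop.coe_le_coe.2 (by simpa using hs)
  have hG : Measurable fun y : Fin K × ℝ => ∫⁻ x, g (y.1, x) ∂(E.dist (B.θ y.1)) :=
    measurable_of_arms fun a =>
      (measurable_const : Measurable fun _ : ℝ => ∫⁻ x, g (a, x) ∂(E.dist (B.θ a)))
  rw [hsum g hg, hsum _ hG]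
  congr 1
  funext s
  obtain ⟨T, hT, hTS⟩ := measurableSet_history_iff.1 (hm s)
  have hind : ∀ (φ : Fin K × ℝ → ℝ≥0∞) (ω : Play K),
      {ω | (s : WithTop ℕ) < π.τ ω}.indicator (fun ω => φ (ω s)) ω =
        T.indicator 1 (past s ω) * φ (ω s) := by
    intro φ ω
    rw [← hTS]
    by_cases h : past s ω ∈ T
    · rw [Set.indicator_of_mem h, Set.indicator_of_mem (show ω ∈ past s ⁻¹' T from h)]
      simp
    · rw [Set.indicator_of_notMem h, Set.indicator_of_notMem (show ω ∉ past s ⁻¹' T from h)]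
      simp
  have hTm : Measurable (T.indicator (1 : (Fin s → Fin K × ℝ) → ℝ≥0∞)) :=
    measurable_one.indicator hT
  have h1 := lintegral_law_step B π s (f := fun p => T.indicator 1 p.1 * g p.2)
    ((hTm.comp measurable_fst).mul (hg.comp measurable_snd))
  have h2 := lintegral_law_step B π s
    (f := fun p => T.indicator 1 p.1 * ∫⁻ x, g (p.2.1, x) ∂(E.dist (B.θ p.2.1)))
    ((hTm.comp measurable_fst).mul (hG.comp measurable_snd))
  refine (lintegral_congr (hind g)).trans (h1.trans (Eq.trans ?_ (h2.symm.trans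
    (lintegral_congr (hind fun y => ∫⁻ x, g (y.1, x) ∂(E.dist (B.θ y.1)))).symm)))
  refine lintegral_congr fun ω => lintegral_congr fun a => ?_
  have := E.isProbabilityMeasure_dist (B.mem a)
  have hga : Measurable fun x => g (a, x) := hg.comp measurable_prodMk_left
  simp only
  rw [lintegral_const_mul _ hga, lintegral_const, measure_univ, mul_one]

/-- The expected number of pulls of arm `a` before the algorithm stops. -/
noncomputable def pulls (B : Bandit E K) (π : Algorithm K) (a : Fin K) : ℝ≥0∞ :=
  ∫⁻ ω, stoppedSum π (fun y => if y.1 = a then 1 else 0) ω ∂(law B π)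

theorem lintegral_stoppedSum_arm (B : Bandit E K) (π : Algorithm K) (G : Fin K → ℝ≥0∞) :
    ∫⁻ ω, stoppedSum π (fun y => G y.1) ω ∂(law B π) = ∑ a, pulls B π a * G a := by
  have hm : ∀ a : Fin K, Measurable (stoppedSum π fun y => if y.1 = a then (1 : ℝ≥0∞) else 0) :=
    fun a => measurable_stoppedSum π
      (measurable_of_arms (f := fun y => if y.1 = a then (1 : ℝ≥0∞) else 0) fun c =>
        (measurable_const : Measurable fun _ : ℝ => if c = a then (1 : ℝ≥0∞) else 0))
  simp only [pulls]
  simp only [← lintegral_mul_const _ (hm _)]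
  rw [← lintegral_finsetSum _ fun a _ => (hm a).mul_const _]
  refine lintegral_congr fun ω => ?_
  simp only [stoppedSum, Finset.sum_mul]
  rw [Finset.sum_comm]
  refine Finset.sum_congr rfl fun s _ => ?_
  simp

theorem sum_pulls (B : Bandit E K) (π : Algorithm K) (hB : ∀ᵐ ω ∂(law B π), π.τ ω ≠ ⊤) :
    ∑ a, pulls B π a = expectedSamples B π := by
  have h := lintegral_stoppedSum_arm B π (fun _ => 1)
  simp only [mul_one] at h
  rw [← h, expectedSamples]
  refine lintegral_congr_ae ?_
  filter_upwards [hB] with ω hω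
  obtain ⟨n, hn⟩ := WithTop.ne_top_iff_exists.1 hω
  rw [stoppedSum, ← hn]
  simp
  rfl

/-- Wald's identity: for integrable summands and a stopping time of finite expectation, the
expected stopped sum is the sum over the arms of the expected number of pulls times the
expectation of a summand. -/
theorem integral_stoppedSum (B : Bandit E K) (π : Algorithm K)
    (hB : ∀ᵐ ω ∂(law B π), π.τ ω ≠ ⊤) (hfin : expectedSamples B π ≠ ⊤) {φ : Fin K × ℝ → ℝ}
    (hφ : Measurable φ) (hint : ∀ a, Integrable (fun x => φ (a, x)) (E.dist (B.θ a))) :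
    Integrable (stoppedSum π φ) (law B π) ∧
      ∫ ω, stoppedSum π φ ω ∂(law B π) =
        ∑ a, (pulls B π a).toReal * ∫ x, φ (a, x) ∂(E.dist (B.θ a)) := by
  have hpulls : ∀ a, pulls B π a ≠ ⊤ := fun a => by
    rw [← sum_pulls B π hB] at hfin
    exact (ENNReal.sum_ne_top.1 hfin) a (Finset.mem_univ a)
  have hpart : ∀ ψ : Fin K × ℝ → ℝ, Measurable ψ →
      ∫⁻ ω, stoppedSum π (fun y => ENNReal.ofReal (ψ y)) ω ∂(law B π) =
        ∑ a, pulls B π a * ∫⁻ x, ENNReal.ofReal (ψ (a, x)) ∂(E.dist (B.θ a)) := by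
    intro ψ hψ
    rw [lintegral_stoppedSum B π hB hψ.ennreal_ofReal]
    exact lintegral_stoppedSum_arm B π
      (fun a => ∫⁻ x, ENNReal.ofReal (ψ (a, x)) ∂(E.dist (B.θ a)))
  have hne : ∀ ψ : Fin K × ℝ → ℝ, Measurable ψ →
      (∀ a, Integrable (fun x => ψ (a, x)) (E.dist (B.θ a))) →
      ∫⁻ ω, stoppedSum π (fun y => ENNReal.ofReal (ψ y)) ω ∂(law B π) ≠ ⊤ := by
    intro ψ hψ hi
    rw [hpart ψ hψ]
    exact ENNReal.sum_ne_top.2 fun a _ =>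
      ENNReal.mul_ne_top (hpulls a) (hi a).lintegral_lt_top.ne
  have hmeas : ∀ ψ : Fin K × ℝ → ℝ, Measurable ψ →
      Measurable (stoppedSum π fun y => ENNReal.ofReal (ψ y)) := fun ψ hψ =>
    measurable_stoppedSum π hψ.ennreal_ofReal
  have hneg : ∀ a, Integrable (fun x => -φ (a, x)) (E.dist (B.θ a)) := fun a => (hint a).neg
  have hsplit : stoppedSum π φ = fun ω =>
      (stoppedSum π (fun y => ENNReal.ofReal (φ y)) ω).toReal -
        (stoppedSum π (fun y => ENNReal.ofReal (-φ y)) ω).toReal := by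
    funext ω
    simp only [stoppedSum]
    rw [ENNReal.toReal_sum (fun _ _ => ENNReal.ofReal_ne_top),
      ENNReal.toReal_sum (fun _ _ => ENNReal.ofReal_ne_top), ← Finset.sum_sub_distrib]
    refine Finset.sum_congr rfl fun s _ => ?_
    rw [ENNReal.toReal_ofReal', ENNReal.toReal_ofReal']
    exact (max_zero_sub_eq_self (φ (ω s))).symm
  have h1 := integrable_toReal_of_lintegral_ne_top (hmeas φ hφ).aemeasurable (hne φ hφ hint)
  have h2 := integrable_toReal_of_lintegral_ne_top (hmeas (fun y => -φ y) hφ.neg).aemeasurable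
    (hne (fun y => -φ y) hφ.neg hneg)
  rw [hsplit]
  refine ⟨h1.sub h2, ?_⟩
  rw [integral_sub h1 h2,
    integral_toReal (hmeas φ hφ).aemeasurable
      (ae_lt_top (hmeas φ hφ) (hne φ hφ hint)),
    integral_toReal (hmeas (fun y => -φ y) hφ.neg).aemeasurable
      (ae_lt_top (hmeas (fun y => -φ y) hφ.neg) (hne (fun y => -φ y) hφ.neg hneg)),
    hpart φ hφ, hpart (fun y => -φ y) hφ.neg,
    ENNReal.toReal_sum fun a _ => ENNReal.mul_ne_top (hpulls a) (hint a).lintegral_lt_top.ne,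
    ENNReal.toReal_sum fun a _ => ENNReal.mul_ne_top (hpulls a) (hneg a).lintegral_lt_top.ne,
    ← Finset.sum_sub_distrib]
  refine Finset.sum_congr rfl fun a _ => ?_
  rw [integral_eq_lintegral_pos_part_sub_lintegral_neg_part (hint a), ENNReal.toReal_mul,
    ENNReal.toReal_mul, mul_sub]

end BAI

/-! ### Instances and their alternatives -/

namespace BAI

variable {E : ExpFamily} {K : ℕ}

namespace Bandit

theorem not_ae_const (B : Bandit E K) (hK : 2 ≤ K) (c : ℝ) : ¬ ∀ᵐ x ∂E.ρ, x = c := by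
  have : Nontrivial (Fin K) := Fin.nontrivial_iff_two_le.2 hK
  obtain ⟨i, hi⟩ := exists_ne B.best
  exact ExpFamily.not_ae_const_of_mean_ne (B.mem i) (B.mem B.best) (B.best_unique i hi).ne c

theorem θ_lt (B : Bandit E K) (hK : 2 ≤ K) {i : Fin K} (hi : i ≠ B.best) : B.θ i < B.θ B.best :=
  ((ExpFamily.strictMonoOn_mean (B.not_ae_const hK)).lt_iff_lt (B.mem i) (B.mem B.best)).1
    (B.best_unique i hi)

theorem exists_ne_mem_Θ (B : Bandit E K) (hK : 2 ≤ K) (η : ℝ) : ∃ η' ∈ E.Θ, η' ≠ η := by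
  have : Nontrivial (Fin K) := Fin.nontrivial_iff_two_le.2 hK
  obtain ⟨i, hi⟩ := exists_ne B.best
  by_cases h : B.θ i = η
  · exact ⟨_, B.mem B.best, fun h' => (B.θ_lt hK hi).ne (h.trans h'.symm)⟩
  · exact ⟨_, B.mem i, h⟩

theorem integrable_reward (B : Bandit E K) (hK : 2 ≤ K) (a : Fin K) :
    Integrable (fun x => x) (E.dist (B.θ a)) := by
  obtain ⟨η, hη, hne⟩ := B.exists_ne_mem_Θ hK (B.θ a)
  exact ExpFamily.integrable_id_dist (B.mem a) hη hne

theorem μ_eq_b' (B : Bandit E K) (hK : 2 ≤ K) (a : Fin K) : B.μ a = E.b' (B.θ a) := by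
  obtain ⟨η, hη, hne⟩ := B.exists_ne_mem_Θ hK (B.θ a)
  exact ExpFamily.mean_eq_b' (B.mem a) hη hne

theorem gap_pos (B : Bandit E K) {i : Fin K} (hi : i ≠ B.best) : 0 < B.gap i :=
  sub_pos.2 (B.best_unique i hi)

theorem gap_best (B : Bandit E K) : B.gap B.best = 0 := sub_self _

/-- The instance in which arm `i` gets the parameter `η₁`, the best arm of `B` gets the smaller
parameter `η₂`, and the other arms are unchanged; if `η₁` exceeds the parameters of the other
arms, arm `i` is the best one. -/
noncomputable def swap (B : Bandit E K) (hK : 2 ≤ K) {i : Fin K} (hi : i ≠ B.best) {η₁ η₂ : ℝ}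
    (h₁ : η₁ ∈ E.Θ) (h₂ : η₂ ∈ E.Θ) (hlt : η₂ < η₁) (hη : ∀ j, j ≠ B.best → B.θ j < η₁) :
    Bandit E K where
  θ := Function.update (Function.update B.θ B.best η₂) i η₁
  mem j := by
    by_cases hj : j = i
    · subst hj; simpa using h₁
    · by_cases hjb : j = B.best
      · subst hjb; simpa [hj] using h₂
      · simpa [hj, hjb] using B.mem j
  best := i
  best_unique j hj := by
    have hmono := ExpFamily.strictMonoOn_mean (B.not_ae_const hK)
    by_cases hjb : j = B.best
    · subst hjb
      simpa [hj] using hmono h₂ h₁ hlt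
    · simpa [hj, hjb] using hmono (B.mem j) h₁ (hη j hjb)

end Bandit

/-! ### The information lower bound and the regret -/

theorem integrable_llr (B B' : Bandit E K) (hK : 2 ≤ K) (a : Fin K) :
    Integrable (fun x => llr B B' (a, x)) (E.dist (B.θ a)) := by
  have := E.isProbabilityMeasure_dist (B.mem a)
  simp only [llr]
  exact (integrable_const _).sub ((B.integrable_reward hK a).const_mul _)

theorem integral_llr (B B' : Bandit E K) (hK : 2 ≤ K) (a : Fin K) :
    ∫ x, llr B B' (a, x) ∂(E.dist (B.θ a)) = E.kl (B.θ a) (B'.θ a) := by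
  have := E.isProbabilityMeasure_dist (B.mem a)
  simp only [llr]
  rw [integral_sub (integrable_const _) ((B.integrable_reward hK a).const_mul _),
    integral_const_mul, ExpFamily.kl, ← B.μ_eq_b' hK, Bandit.μ, ExpFamily.mean]
  simp only [integral_const, probReal_univ, one_smul]
  ring

/-- The information lower bound: an algorithm that is `δ`-PAC has to collect `log (1/δ) - 2` units
of information against each instance with another best arm. -/
theorem log_sub_two_le_sum_pulls (hK : 2 ≤ K) {π : Algorithm K} {δ : ℝ} (hδ : 0 < δ) (hδ1 : δ < 1)
    (hpac : IsPAC E δ π) (B B' : Bandit E K) (hbest : B'.best ≠ B.best)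
    (hfin : expectedSamples B π ≠ ⊤) :
    Real.log (1 / δ) - 2 ≤ ∑ a, (pulls B π a).toReal * E.kl (B.θ a) (B'.θ a) := by
  obtain ⟨hτ, herr⟩ := hpac B
  obtain ⟨hτ', herr'⟩ := hpac B'
  obtain ⟨hZi, hZ⟩ := integral_stoppedSum B π hτ hfin (measurable_llr B B')
    (integrable_llr B B' hK)
  simp only [integral_llr B B' hK] at hZ
  rw [← hZ]
  set Z := stoppedSum π (llr B B') with hZdef
  have hZm : Measurable Z := measurable_stoppedSum π (measurable_llr B B')
  set A : Set (Play K) := {ω | π.out ω = B.best} with hA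
  have hAτ : MeasurableSet[π.τ_stopping.measurableSpace] A :=
    π.out_measurable (measurableSet_singleton B.best)
  have hAm : MeasurableSet A := π.τ_stopping.measurableSpace_le _ hAτ
  have hexpm : Measurable fun ω => Real.exp (-Z ω) := by fun_prop
  have hall : ∫⁻ ω, ENNReal.ofReal (Real.exp (-Z ω)) ∂(law B π) = 1 := by
    have h := law_change B B' π (A := Set.univ) MeasurableSet.univ hτ hτ'
    rw [measure_univ, Measure.restrict_univ] at h
    exact h.symm
  have hexpi : Integrable (fun ω => Real.exp (-Z ω)) (law B π) := by
    refine ⟨hexpm.aestronglyMeasurable, ?_⟩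
    rw [hasFiniteIntegral_iff_ofReal (Eventually.of_forall fun ω => (Real.exp_pos _).le), hall]
    exact ENNReal.one_lt_top
  have hint : ∀ S : Set (Play K), ENNReal.ofReal (∫ ω in S, Real.exp (-Z ω) ∂(law B π)) =
      ∫⁻ ω in S, ENNReal.ofReal (Real.exp (-Z ω)) ∂(law B π) := fun S =>
    ofReal_integral_eq_lintegral_ofReal hexpi.integrableOn
      (Eventually.of_forall fun ω => (Real.exp_pos _).le)
  have hAexp : ∫ ω in A, Real.exp (-Z ω) ∂(law B π) ≤ δ := by
    rw [← ENNReal.ofReal_le_ofReal_iff hδ.le, hint, ← law_change B B' π hAτ hτ hτ']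
    refine le_trans (measure_mono fun ω hω => ?_) herr'
    exact fun h => hbest (h.symm.trans hω)
  have hAcexp : ∫ ω in Aᶜ, Real.exp (-Z ω) ∂(law B π) ≤ 1 := by
    rw [← ENNReal.ofReal_le_ofReal_iff zero_le_one, hint, ENNReal.ofReal_one, ← hall]
    exact setLIntegral_le_lintegral _ _
  have hPc : (law B π).real Aᶜ ≤ δ := by
    refine ENNReal.toReal_le_of_le_ofReal hδ.le ?_
    exact herr
  set L := Real.log (1 / δ) with hL
  have hLexp : Real.exp L = δ⁻¹ := by
    rw [hL, Real.exp_log (by positivity), one_div]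
  -- the tangent line of `exp` at `L` is used where the answer is right, that at `0` elsewhere
  have h1 : ∫ ω in A, (1 + L - Z ω) ∂(law B π) ≤ δ⁻¹ * ∫ ω in A, Real.exp (-Z ω) ∂(law B π) := by
    rw [← integral_const_mul]
    refine integral_mono ((integrable_const _).sub hZi.integrableOn)
      (hexpi.integrableOn.const_mul _) fun ω => ?_
    simp only
    rw [← hLexp, ← Real.exp_add]
    linarith [Real.add_one_le_exp (L + -Z ω)]
  have h2 : ∫ ω in Aᶜ, (1 - Z ω) ∂(law B π) ≤ ∫ ω in Aᶜ, Real.exp (-Z ω) ∂(law B π) := by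
    refine integral_mono ((integrable_const _).sub hZi.integrableOn) hexpi.integrableOn fun ω => ?_
    simp only
    linarith [Real.add_one_le_exp (-Z ω)]
  rw [integral_sub (integrable_const _) hZi.integrableOn, setIntegral_const, smul_eq_mul] at h1 h2
  have h3 := integral_add_compl hAm hZi
  have h4 : (law B π).real Aᶜ = 1 - (law B π).real A := probReal_compl_eq_one_sub hAm
  have h5 : δ⁻¹ * ∫ ω in A, Real.exp (-Z ω) ∂(law B π) ≤ 1 := by
    rw [inv_mul_le_iff₀ hδ, mul_one]
    exact hAexp
  have h6 : δ * L ≤ 1 := by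
    have h := Real.log_le_sub_one_of_pos (show (0 : ℝ) < 1 / δ by positivity)
    calc δ * L ≤ δ * (1 / δ - 1) := by gcongr
      _ = 1 - δ := by field_simp
      _ ≤ 1 := by linarith
  have h7 : 0 ≤ L := Real.log_nonneg (by rw [le_div_iff₀ hδ]; linarith)
  nlinarith [mul_le_mul_of_nonneg_right hPc h7]

/-- By Wald's identity, the expected regret is the expected number of pulls weighted by the gaps. -/
theorem expectedRegret_eq (hK : 2 ≤ K) (B : Bandit E K) (π : Algorithm K)
    (hτ : ∀ᵐ ω ∂(law B π), π.τ ω ≠ ⊤) (hfin : expectedSamples B π ≠ ⊤) :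
    expectedRegret B π = ((∑ a, (pulls B π a).toReal * B.gap a : ℝ) : EReal) := by
  have hprob : ∀ a, IsProbabilityMeasure (E.dist (B.θ a)) := fun a =>
    E.isProbabilityMeasure_dist (B.mem a)
  obtain ⟨hi, h⟩ := integral_stoppedSum B π hτ hfin (φ := fun y => B.μ B.best - y.2)
    (measurable_snd.const_sub _)
    fun a => (integrable_const _).sub (B.integrable_reward hK a)
  have hgap : ∀ a, ∫ x, (B.μ B.best - x) ∂(E.dist (B.θ a)) = B.gap a := fun a => by
    rw [integral_sub (integrable_const _) (B.integrable_reward hK a)]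
    simp [Bandit.gap, Bandit.μ, ExpFamily.mean]
  simp only [hgap] at h
  change Integrable (regret B π) (law B π) at hi
  change ∫ ω, regret B π ω ∂(law B π) = _ at h
  have hneg : ∫⁻ ω, ENNReal.ofReal (-regret B π ω) ∂(law B π) ≠ ⊤ := hi.neg.lintegral_lt_top.ne
  rw [← h, integral_eq_lintegral_pos_part_sub_lintegral_neg_part hi, expectedRegret,
    EReal.coe_sub, EReal.coe_ennreal_toReal hi.lintegral_lt_top.ne,
    EReal.coe_ennreal_toReal hneg]

/-- Moving the best arm down by `2 s` costs `o(s)` in divergence, while replacing the target of a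
suboptimal arm by a parameter `s` below the best one saves an amount of order `s`. So for small
`s` the saving wins, whatever the constant `c`. -/
theorem eventually_kl_div_add_lt (B : Bandit E K) (hK : 2 ≤ K) (c : ℝ) {i : Fin K}
    (hi : i ≠ B.best) :
    ∀ᶠ s in 𝓝[>] (0 : ℝ), E.kl (B.θ i) (B.θ B.best - s) / E.kl (B.θ i) (B.θ B.best) +
      c * E.kl (B.θ B.best) (B.θ B.best - 2 * s) < 1 := by
  set θs := B.θ B.best with hθs
  have hlt : B.θ i < θs := B.θ_lt hK hi
  have hkl : 0 < E.kl (B.θ i) θs :=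
    ExpFamily.kl_pos (B.not_ae_const hK) (B.mem i) (B.mem _) hlt.ne'
  set d := (θs - B.θ i) / 2 with hd
  have hdpos : 0 < d := by rw [hd]; linarith
  have hseg : ∀ x, B.θ i ≤ x → x ≤ θs → x ∈ E.Θ := fun x h1 h2 =>
    ExpFamily.convex_Θ.ordConnected.out (B.mem i) (B.mem B.best) ⟨h1, h2⟩
  have hb : ∀ k : ℝ, 0 ≤ k → k ≤ 2 →
      HasDerivWithinAt (fun s => E.b (θs - k * s)) (E.b' θs * -k) (Set.Ioc 0 d) 0 := by
    intro k hk0 hk2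
    have h1 : HasDerivWithinAt (fun s : ℝ => θs - k * s) (-k) (Set.Ioc 0 d) 0 := by
      simpa using (((hasDerivAt_id (0 : ℝ)).const_mul k).const_sub θs).hasDerivWithinAt
    have h2 : HasDerivWithinAt E.b (E.b' θs) E.Θ (θs - k * 0) := by
      simpa using ExpFamily.hasDerivWithinAt_b (B.mem B.best)
    refine h2.comp 0 h1 fun s hs => hseg _ ?_ ?_
    · have : k * s ≤ 2 * d := mul_le_mul hk2 hs.2 hs.1.le zero_le_two
      rw [hd] at this
      linarith
    · have := mul_nonneg hk0 hs.1.le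
      linarith
  have hkl' : ∀ (η k : ℝ), 0 ≤ k → k ≤ 2 →
      HasDerivWithinAt (fun s => E.kl η (θs - k * s)) (E.b' θs * -k - E.b' η * -k)
        (Set.Ioc 0 d) 0 := by
    intro η k hk0 hk2
    have h1 : HasDerivWithinAt (fun s : ℝ => θs - k * s - η) (-k) (Set.Ioc 0 d) 0 := by
      simpa using
        ((((hasDerivAt_id (0 : ℝ)).const_mul k).const_sub θs).sub_const η).hasDerivWithinAt
    exact ((hb k hk0 hk2).sub_const (E.b η)).sub (h1.const_mul (E.b' η))
  have hh := ((hkl' (B.θ i) 1 zero_le_one one_le_two).div_const (E.kl (B.θ i) θs)).add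
    ((hkl' θs 2 zero_le_two le_rfl).const_mul c)
  have hslope := (hasDerivWithinAt_iff_tendsto_slope' (by simp)).1 hh
  rw [nhdsWithin_Ioc_eq_nhdsGT hdpos] at hslope
  have hneg : (E.b' θs * -1 - E.b' (B.θ i) * -1) / E.kl (B.θ i) θs +
      c * (E.b' θs * -2 - E.b' θs * -2) < 0 := by
    have hgap := B.gap_pos hi
    rw [Bandit.gap, B.μ_eq_b' hK, B.μ_eq_b' hK] at hgap
    rw [sub_self, mul_zero, add_zero]
    exact div_neg_of_neg_of_pos (by linarith) hkl
  filter_upwards [hslope.eventually_lt_const hneg, self_mem_nhdsWithin] with s hs hs0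
  have hs0' : (0 : ℝ) < s := hs0
  rw [slope_def_field, sub_zero, div_neg_iff] at hs
  rcases hs with ⟨-, h⟩ | ⟨h, -⟩
  · linarith
  · simp only [Pi.add_apply, one_mul, mul_zero, sub_zero, ExpFamily.kl_self, add_zero] at h
    rw [div_self hkl.ne'] at h
    linarith

end BAI

/-! ### Impossibility of a sample complexity of order `log (1/δ)` -/

open BAI

theorem theorem2 (E : BAI.ExpFamily) (K : ℕ) (hK : 2 ≤ K) (π : ℝ → BAI.Algorithm K)
    (hpac : ∀ δ : ℝ, 0 < δ → δ < 1 → BAI.IsPAC E δ (π δ))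
    (hopt : BAI.IsAsymptoticallyOptimal E π) (B : BAI.Bandit E K) :
    liminf (fun δ : ℝ => BAI.expectedSamples B (π δ) / ENNReal.ofReal (Real.log (1 / δ))) (𝓝[>] 0)
      = ⊤ := by
  by_contra hne
  obtain ⟨C, hC, hCtop⟩ := exists_between (lt_top_iff_ne_top.2 hne)
  have hfreq := frequently_lt_of_liminf_lt (by isBoundedDefault) hC
  set c := C.toReal with hc
  set θs := B.θ B.best with hθs
  have : Nontrivial (Fin K) := Fin.nontrivial_iff_two_le.2 hK
  obtain ⟨i₀, hi₀⟩ := exists_ne B.best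
  have hρ := B.not_ae_const hK
  -- the parameters `θs - s` and `θs - 2 * s` of the alternative instances
  obtain ⟨s, hs0, hsmem, hslt, hskl⟩ : ∃ s : ℝ, 0 < s ∧ B.θ i₀ ≤ θs - 2 * s ∧
      (∀ j, j ≠ B.best → B.θ j < θs - s) ∧
      ∀ j, j ≠ B.best → E.kl (B.θ j) (θs - s) / E.kl (B.θ j) θs +
        c * E.kl θs (θs - 2 * s) < 1 := by
    have h1 : ∀ᶠ s in 𝓝[>] (0 : ℝ), ∀ j, j ≠ B.best → B.θ j < θs - s := by
      rw [eventually_all]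
      intro j
      by_cases hj : j = B.best
      · simp [hj]
      · filter_upwards [Ioo_mem_nhdsGT (sub_pos.2 (B.θ_lt hK hj))] with s hs _
        linarith [hs.2]
    have h2 : ∀ᶠ s in 𝓝[>] (0 : ℝ), ∀ j, j ≠ B.best →
        E.kl (B.θ j) (θs - s) / E.kl (B.θ j) θs + c * E.kl θs (θs - 2 * s) < 1 := by
      rw [eventually_all]
      intro j
      by_cases hj : j = B.best
      · simp [hj]
      · filter_upwards [eventually_kl_div_add_lt B hK c hj] with s hs _
        exact hs
    have h3 : ∀ᶠ s in 𝓝[>] (0 : ℝ), B.θ i₀ ≤ θs - 2 * s := by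
      filter_upwards [Ioo_mem_nhdsGT (half_pos (sub_pos.2 (B.θ_lt hK hi₀)))] with s hs
      linarith [hs.2]
    obtain ⟨s, hs⟩ := (h1.and (h2.and (h3.and self_mem_nhdsWithin))).exists
    exact ⟨s, hs.2.2.2, hs.2.2.1, hs.1, hs.2.1⟩
  obtain ⟨β, hβ0, hβ⟩ : ∃ β : ℝ, 0 < β ∧ ∀ j, j ≠ B.best →
      E.kl (B.θ j) (θs - s) / E.kl (B.θ j) θs + c * E.kl θs (θs - 2 * s) < 1 - β := by
    have h : ∀ᶠ β in 𝓝[>] (0 : ℝ), ∀ j, j ≠ B.best →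
        E.kl (B.θ j) (θs - s) / E.kl (B.θ j) θs + c * E.kl θs (θs - 2 * s) < 1 - β := by
      rw [eventually_all]
      intro j
      by_cases hj : j = B.best
      · simp [hj]
      · filter_upwards [Ioo_mem_nhdsGT (sub_pos.2 (hskl j hj))] with β hβ _
        linarith [hβ.2]
    obtain ⟨β, hβ⟩ := (h.and self_mem_nhdsWithin).exists
    exact ⟨β, hβ.2, hβ.1⟩
  have h₁ : θs - s ∈ E.Θ :=
    ExpFamily.convex_Θ.ordConnected.out (B.mem i₀) (B.mem B.best) ⟨by linarith, by linarith⟩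
  have h₂ : θs - 2 * s ∈ E.Θ :=
    ExpFamily.convex_Θ.ordConnected.out (B.mem i₀) (B.mem B.best) ⟨hsmem, by linarith⟩
  have hkl₂ : 0 ≤ E.kl θs (θs - 2 * s) :=
    (ExpFamily.kl_pos hρ (B.mem B.best) h₂ (by linarith)).le
  have hkl₁ : ∀ j, j ≠ B.best → 0 < E.kl (B.θ j) (θs - s) := fun j hj =>
    ExpFamily.kl_pos hρ (B.mem j) h₁ (hslt j hj).ne'
  set w := 1 - β - c * E.kl θs (θs - 2 * s) with hw
  -- the normalized regret that is forced if `𝔼 τ ≤ C log (1/δ)`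
  set V := ∑ j ∈ Finset.univ.erase B.best, B.gap j * (w / E.kl (B.θ j) (θs - s)) with hV
  have hVlt : B.hardness < V := by
    refine Finset.sum_lt_sum_of_nonempty ⟨i₀, by simpa using hi₀⟩ fun j hj => ?_
    have hj' : j ≠ B.best := Finset.ne_of_mem_erase hj
    have hk := ExpFamily.kl_pos hρ (B.mem j) (B.mem B.best) (B.θ_lt hK hj').ne'
    rw [div_eq_mul_inv]
    refine mul_lt_mul_of_pos_left ?_ (B.gap_pos hj')
    rw [lt_div_iff₀ (hkl₁ j hj'), inv_mul_eq_div, hw]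
    linarith [hβ j hj']
  have hev := eventually_lt_of_limsup_lt
    (lt_of_le_of_lt (hopt B) (EReal.coe_lt_coe_iff.2 hVlt)) (by isBoundedDefault)
  have hsmall : ∀ᶠ δ in 𝓝[>] (0 : ℝ), δ ∈ Set.Ioo 0 (min 1 (Real.exp (-(2 / β)))) :=
    Ioo_mem_nhdsGT (by positivity)
  obtain ⟨δ, hEτ, hR, hδ0, hδ⟩ := (hfreq.and_eventually (hev.and hsmall)).exists
  have hδ1 : δ < 1 := hδ.trans_le (min_le_left _ _)
  have hP := hpac δ hδ0 hδ1
  set L := Real.log (1 / δ) with hL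
  have hLβ : 2 / β < L := by
    have h := Real.log_lt_log hδ0 (hδ.trans_le (min_le_right _ _))
    rw [Real.log_exp] at h
    rw [hL, one_div, Real.log_inv]
    linarith
  have hL0 : 0 < L := lt_trans (by positivity) hLβ
  have hτle : expectedSamples B (π δ) ≤ C * ENNReal.ofReal L :=
    ((ENNReal.div_lt_iff (Or.inl (ENNReal.ofReal_pos.2 hL0).ne')
      (Or.inl ENNReal.ofReal_ne_top)).1 hEτ).le
  have hCL : C * ENNReal.ofReal L ≠ ⊤ := ENNReal.mul_ne_top hCtop.ne ENNReal.ofReal_ne_top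
  have hfin : expectedSamples B (π δ) ≠ ⊤ := ne_top_of_le_ne_top hCL hτle
  set N : Fin K → ℝ := fun a => (pulls B (π δ) a).toReal with hN
  have hNbest : N B.best ≤ c * L := by
    have h : pulls B (π δ) B.best ≤ C * ENNReal.ofReal L := by
      refine le_trans ?_ hτle
      rw [← sum_pulls B (π δ) (hP B).1]
      exact Finset.single_le_sum (f := pulls B (π δ)) (fun _ _ => zero_le) (Finset.mem_univ _)
    have h' := ENNReal.toReal_mono hCL h
    rwa [ENNReal.toReal_mul, ENNReal.toReal_ofReal hL0.le] at h'
  have hNj : ∀ j, j ≠ B.best → L * (w / E.kl (B.θ j) (θs - s)) ≤ N j := by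
    intro j hj
    have hinfo := log_sub_two_le_sum_pulls hK hδ0 hδ1 hP B
      (B.swap hK hj h₁ h₂ (by linarith) hslt) hj hfin
    rw [Finset.sum_eq_add j B.best hj] at hinfo
    · simp only [Bandit.swap, Function.update_self, Function.update_of_ne hj.symm] at hinfo
      rw [← mul_div_assoc, div_le_iff₀ (hkl₁ j hj)]
      have hb : N B.best * E.kl θs (θs - 2 * s) ≤ c * L * E.kl θs (θs - 2 * s) :=
        mul_le_mul_of_nonneg_right hNbest hkl₂
      have h2 : 2 ≤ β * L := by
        rw [div_lt_iff₀ hβ0] at hLβ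
        linarith
      rw [hw]
      linarith
    · intro a _ ha
      simp [Bandit.swap, Function.update_of_ne ha.1, Function.update_of_ne ha.2,
        ExpFamily.kl_self]
    · simp
    · simp
  rw [expectedRegret_eq hK B (π δ) (hP B).1 hfin, ← EReal.coe_div, EReal.coe_lt_coe_iff,
    div_lt_iff₀ hL0] at hR
  have hge : V * L ≤ ∑ a, N a * B.gap a := by
    rw [← Finset.add_sum_erase _ _ (Finset.mem_univ B.best), B.gap_best, mul_zero, zero_add, hV,
      Finset.sum_mul]
    refine Finset.sum_le_sum fun j hj => ?_
    have hj' : j ≠ B.best := Finset.ne_of_mem_erase hj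
    have := mul_le_mul_of_nonneg_right (hNj j hj') (B.gap_pos hj').le
    linarith
  linarith
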